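/- Let $n \ge 1$ be an integer. Let $\mathcal{L}_n^*$ be the $(n+1)$-sorted first-order language with sorts $R_0, R_1, \ldots, R_n$, a constant symbol $0$ of sort $R_0$ and, for each $i \in \{1,\ldots,n\}$, a binary relation symbol $<_i$ on $R_i$ and function symbols $f_i : R_0 \to R_i$ and $g_i : R_i \to R_0$. Let $VO_n$ be the $\mathcal{L}_n^*$-theory with the following axioms: 1. for each $i \in \{1,\ldots,n\}$, $<_i$ is a dense linear order without endpoints on $R_i$; 2. for each $i$, $f_i : R_0 \to R_i$ is injective; 3. for each $i$ and each $y \in R_i$, $g_i(y) = f_i^{-1}(y)$ if $y \in f_i(R_0)$, and $g_i(y) = 0$ otherwise; 4. for each $i$, both $f_i(R_0)$ and $R_i \setminus f_i(R_0)$ are $<_i$-dense in $R_i$; 5. whenever $a_i, b_i \in R_i$ satisfy $a_i <_i b_i$ for all $i \in \{1,\ldots,n\}$, there is a single $x \in R_0$ such that $a_i <_i f_i(x) <_i b_i$ for all $i \in \{1,\ldots,n\}$. Then $VO_n$ eliminates imaginaries. That is, let $M$ be any model of $VO_n$, let $S$ be a finite product of sorts of $M$, let $E$ be an equivalence relation on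 $S$ that is definable without parameters, and let $a \in S$. Then there are a finite tuple $c$ of elements of $M$ (from some sorts) and an $\mathcal{L}_n^*$-formula $\varphi(x,z)$ without parameters such that the $E$-class of $a$ equals $\{x \in S : M \models \varphi(x,c)\}$, and $c$ is the only tuple $c'$ from the same sorts for which the $E$-class of $a$ equals $\{x \in S : M \models \varphi(x,c')\}$. -/

import Mathlib

universe u

/-! ### Many-sorted first-order logic -/

namespace ManySorted

/-- A many-sorted first-order language with set of sorts `S`: `Func a s` is the type of function
symbols of arity `a 0 × ⋯ × a (k-1) → s` (constants for `k = 0`), and `Rel a` is the type of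
relation symbols on `a 0 × ⋯ × a (k-1)`. Equality on each sort is a logical symbol. -/
structure Language (S : Type) where
  Func : {k : ℕ} → (Fin k → S) → S → Type
  Rel : {k : ℕ} → (Fin k → S) → Type

variable {S : Type}

/-- An `L`-structure on a family of carriers, one for each sort. -/
class Language.Structure (L : Language S) (M : S → Type u) where
  funMap : ∀ {k : ℕ} {a : Fin k → S} {s : S}, L.Func a s → (∀ j, M (a j)) → M s
  relMap : ∀ {k : ℕ} {a : Fin k → S}, L.Rel a → (∀ j, M (a j)) → Prop

/-- A context is a family `σ : ι → S`: one variable of sort `σ i` for each `i : ι`.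
`extend σ s` adds one new variable `none` of sort `s`. -/
abbrev extend {ι : Type} (σ : ι → S) (s : S) : Option ι → S
  | none => s
  | some i => σ i

/-- Terms with variables in the context `σ`, indexed by their sort. -/
inductive Language.Term (L : Language S) {ι : Type} (σ : ι → S) : S → Type
  | var (i : ι) : L.Term σ (σ i)
  | func {k : ℕ} {a : Fin k → S} {s : S} (f : L.Func a s) (ts : ∀ j, L.Term σ (a j)) : L.Term σ s

/-- First-order formulas with free variables in the context `σ`. -/
inductive Language.Formula (L : Language S) : {ι : Type} → (ι → S) → Type 1
  | falsum {ι : Type} {σ : ι → S} : L.Formula σ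
  | eq {ι : Type} {σ : ι → S} {s : S} (t₁ t₂ : L.Term σ s) : L.Formula σ
  | rel {ι : Type} {σ : ι → S} {k : ℕ} {a : Fin k → S} (R : L.Rel a)
      (ts : ∀ j, L.Term σ (a j)) : L.Formula σ
  | imp {ι : Type} {σ : ι → S} (φ ψ : L.Formula σ) : L.Formula σ
  | all {ι : Type} {σ : ι → S} (s : S) (φ : L.Formula (extend σ s)) : L.Formula σ

/-- Sentences are formulas in the empty context. -/
abbrev Language.Sentence (L : Language S) : Type 1 := L.Formula (fun e : Empty => (e.elim : S))

/-- A theory is a set of sentences. -/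
abbrev Language.Theory (L : Language S) : Type 1 := Set L.Sentence

variable {L : Language S}

namespace Language

/-! #### Semantics -/

section Semantics

variable {M : S → Type u}

/-- Extend an assignment of the variables in `σ` by a value of the new variable. -/
def extendVal {ι : Type} {σ : ι → S} {s : S} (v : ∀ i, M (σ i)) (x : M s) :
    ∀ o, M (extend σ s o)
  | none => x
  | some i => v i

/-- The assignment of the variables in a disjoint union of two contexts. -/
def pairVal {ι κ : Type} {σ : ι → S} {τ : κ → S} (v : ∀ i, M (σ i)) (w : ∀ j, M (τ j)) :
    ∀ o, M (Sum.elim σ τ o)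
  | Sum.inl i => v i
  | Sum.inr j => w j

variable [L.Structure M]

def Term.realize {ι : Type} {σ : ι → S} (v : ∀ i, M (σ i)) : {s : S} → L.Term σ s → M s
  | _, .var i => v i
  | _, .func f ts => Structure.funMap f (fun j => (ts j).realize v)

def Formula.Realize : {ι : Type} → {σ : ι → S} → L.Formula σ → (∀ i, M (σ i)) → Prop
  | _, _, .falsum, _ => False
  | _, _, .eq t₁ t₂, v => t₁.realize v = t₂.realize v
  | _, _, .rel R ts, v => Structure.relMap R (fun j => (ts j).realize v)
  | _, _, .imp φ ψ, v => φ.Realize v → ψ.Realize v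
  | _, _, .all s φ, v => ∀ x : M s, φ.Realize (extendVal v x)

end Semantics

/-- `M` is a model of `T`. -/
def Theory.Models (T : L.Theory) (M : S → Type u) [L.Structure M] : Prop :=
  ∀ φ ∈ T, φ.Realize (fun e : Empty => (e.elim : M e.elim))

/-! #### Substitution and derived connectives -/

def Term.subst {ι κ : Type} {σ : ι → S} {τ : κ → S} (g : ∀ i, L.Term τ (σ i)) :
    {s : S} → L.Term σ s → L.Term τ s
  | _, .var i => g i
  | _, .func f ts => .func f (fun j => (ts j).subst g)

/-- Lift a substitution under a quantifier. -/
def liftSubst {ι κ : Type} {σ : ι → S} {τ : κ → S} (s : S) (g : ∀ i, L.Term τ (σ i)) :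
    ∀ o, L.Term (extend τ s) (extend σ s o)
  | none => .var (σ := extend τ s) none
  | some i => (g i).subst (fun j => .var (σ := extend τ s) (some j))

def Formula.subst : {ι : Type} → {σ : ι → S} → L.Formula σ → {κ : Type} → {τ : κ → S} →
    (∀ i, L.Term τ (σ i)) → L.Formula τ
  | _, _, .falsum, _, _, _ => .falsum
  | _, _, .eq t₁ t₂, _, _, g => .eq (t₁.subst g) (t₂.subst g)
  | _, _, .rel R ts, _, _, g => .rel R (fun j => (ts j).subst g)
  | _, _, .imp φ ψ, _, _, g => .imp (φ.subst g) (ψ.subst g)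
  | _, _, .all s φ, _, _, g => .all s (φ.subst (liftSubst s g))

namespace Formula

variable {ι : Type} {σ : ι → S}

def not (φ : L.Formula σ) : L.Formula σ := φ.imp .falsum

def or (φ ψ : L.Formula σ) : L.Formula σ := φ.not.imp ψ

def and (φ ψ : L.Formula σ) : L.Formula σ := (φ.imp ψ.not).not

def ex (s : S) (φ : L.Formula (extend σ s)) : L.Formula σ := (all s φ.not).not

/-- The conjunction of a finite list of formulas. -/
def conj : List (L.Formula σ) → L.Formula σ
  | [] => falsum.not
  | φ :: l => φ.and (conj l)

/-- `allBlock k τ φ` is `∀ y₀ ⋯ ∀ yₖ₋₁, φ`, where `yⱼ` is a variable of sort `τ j`, named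
`Sum.inr j` in `φ`. -/
def allBlock : {ι : Type} → {σ : ι → S} → (k : ℕ) → (τ : Fin k → S) →
    L.Formula (Sum.elim σ τ) → L.Formula σ
  | _, σ, 0, _, φ => φ.subst (fun o => match o with
      | Sum.inl i => (.var i : L.Term σ (σ i))
      | Sum.inr j => j.elim0)
  | _, σ, k + 1, τ, φ => all (τ 0) (allBlock k (fun j => τ j.succ) (φ.subst (fun o => match o with
      | Sum.inl i => .var (σ := Sum.elim (extend σ (τ 0)) (fun j : Fin k => τ j.succ))
          (Sum.inl (some i))
      | Sum.inr j => Fin.cases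
          (motive := fun j => L.Term (Sum.elim (extend σ (τ 0)) (fun j : Fin k => τ j.succ)) (τ j))
          (.var (σ := Sum.elim (extend σ (τ 0)) (fun j : Fin k => τ j.succ)) (Sum.inl none))
          (fun j' => .var (σ := Sum.elim (extend σ (τ 0)) (fun j : Fin k => τ j.succ))
            (Sum.inr j')) j)))

end Formula

/-! #### Correctness of the derived operations -/

section Correctness

variable {M : S → Type u} [L.Structure M]

theorem Term.realize_subst {ι κ : Type} {σ : ι → S} {τ : κ → S} (g : ∀ i, L.Term τ (σ i))
    (v : ∀ j, M (τ j)) {s : S} (t : L.Term σ s) :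
    (t.subst g).realize v = t.realize (fun i => (g i).realize v) := by
  induction t with
  | var i => rfl
  | func f ts ih => simp only [Term.subst, Term.realize, ih]

theorem Formula.realize_subst {ι : Type} {σ : ι → S} (φ : L.Formula σ) :
    ∀ {κ : Type} {τ : κ → S} (g : ∀ i, L.Term τ (σ i)) (v : ∀ j, M (τ j)),
      (φ.subst g).Realize v ↔ φ.Realize (fun i => (g i).realize v) := by
  induction φ with
  | falsum => intros; rfl
  | eq t₁ t₂ => intro κ τ g v; simp only [Formula.subst, Formula.Realize, Term.realize_subst]
  | rel R ts => intro κ τ g v; simp only [Formula.subst, Formula.Realize, Term.realize_subst]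
  | imp φ ψ h₁ h₂ => intro κ τ g v; simp only [Formula.subst, Formula.Realize, h₁, h₂]
  | all s φ ih =>
    intro κ τ g v
    simp only [Formula.subst, Formula.Realize, ih]
    refine forall_congr' fun x => ?_
    have : (fun o => (liftSubst s g o).realize (extendVal v x)) =
        extendVal (fun i => (g i).realize v) x := by
      funext o
      cases o with
      | none => rfl
      | some i => exact Term.realize_subst _ _ _
    rw [this]

variable {ι : Type} {σ : ι → S} (v : ∀ i, M (σ i))

theorem Formula.realize_not (φ : L.Formula σ) : φ.not.Realize v ↔ ¬ φ.Realize v := Iff.rfl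

theorem Formula.realize_or (φ ψ : L.Formula σ) :
    (φ.or ψ).Realize v ↔ φ.Realize v ∨ ψ.Realize v := by
  simp only [Formula.or, Formula.not, Formula.Realize]; tauto

theorem Formula.realize_and (φ ψ : L.Formula σ) :
    (φ.and ψ).Realize v ↔ φ.Realize v ∧ ψ.Realize v := by
  simp only [Formula.and, Formula.not, Formula.Realize]; tauto

theorem Formula.realize_ex (s : S) (φ : L.Formula (extend σ s)) :
    (Formula.ex s φ).Realize v ↔ ∃ x : M s, φ.Realize (extendVal v x) := by
  simp only [Formula.ex, Formula.not, Formula.Realize, ← not_forall_not]; rfl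

theorem Formula.realize_conj (l : List (L.Formula σ)) :
    (Formula.conj l).Realize v ↔ ∀ φ ∈ l, φ.Realize v := by
  induction l with
  | nil => simp [Formula.conj, Formula.not, Formula.Realize]
  | cons φ l ih => simp [Formula.conj, Formula.realize_and, ih]

theorem Formula.realize_allBlock : ∀ (k : ℕ) {ι : Type} {σ : ι → S} (v : ∀ i, M (σ i))
    (τ : Fin k → S) (φ : L.Formula (Sum.elim σ τ)),
    (Formula.allBlock k τ φ).Realize v ↔ ∀ y : ∀ j, M (τ j), φ.Realize (pairVal v y)
  | 0, ι, σ, v, τ, φ => by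
    rw [Formula.allBlock, Formula.realize_subst]
    have key : ∀ y : ∀ j, M (τ j), (fun o => Term.realize v (match o with
        | Sum.inl i => (.var i : L.Term σ (σ i))
        | Sum.inr j => j.elim0 : L.Term σ (Sum.elim σ τ o))) = pairVal v y := by
      intro y
      funext o
      rcases o with i | j
      · rfl
      · exact j.elim0
    constructor
    · intro h y
      rw [← key y]; exact h
    · intro h
      have := h (fun j => j.elim0)
      rw [← key] at this; exact this
  | k + 1, ι, σ, v, τ, φ => by
    rw [Formula.allBlock, Formula.Realize]
    simp only [Formula.realize_allBlock k, Formula.realize_subst]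
    constructor
    · intro h y
      have := h (y 0) (fun j => y j.succ)
      convert this using 1
      funext o
      rcases o with i | j
      · rfl
      · refine Fin.cases ?_ (fun j => ?_) j <;> rfl
    · intro h x y
      have := h (Fin.cases (motive := fun j => M (τ j)) x y)
      convert this using 1
      funext o
      rcases o with i | j
      · rfl
      · refine Fin.cases ?_ (fun j => ?_) j <;> rfl

end Correctness

/-! #### Elimination of imaginaries -/

/-- `M` eliminates imaginaries: for every equivalence relation `E` that is definable without
parameters on a finite product of sorts, and every class `a / E`, there is a finite tuple `c` of
elements of `M` (of some sorts) and a formula `φ(x, z)` without parameters such that `c` is the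
one and only tuple with `φ(M, c) = a / E`; that is, `a / E` is interdefinable with `c`. -/
def EliminatesImaginariesIn (L : Language S) (M : S → Type u) [L.Structure M] : Prop :=
  ∀ (m : ℕ) (σ : Fin m → S) (E : L.Formula (Sum.elim σ σ)),
    Equivalence (fun x y : (∀ i, M (σ i)) => E.Realize (pairVal x y)) →
    ∀ a : (∀ i, M (σ i)),
      ∃ (k : ℕ) (τ : Fin k → S) (φ : L.Formula (Sum.elim σ τ)) (c : ∀ j, M (τ j)),
        ∀ c' : (∀ j, M (τ j)),
          (∀ x : (∀ i, M (σ i)), φ.Realize (pairVal x c') ↔ E.Realize (pairVal a x)) ↔ c' = c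

/-- A theory eliminates imaginaries if all its models (with carriers in `Type u`) do. -/
def Theory.EliminatesImaginaries (T : L.Theory) : Prop :=
  ∀ (M : S → Type u) [L.Structure M], T.Models M → L.EliminatesImaginariesIn M

end Language

end ManySorted

/-! ### The theory `VO_n` -/

namespace VO

open ManySorted ManySorted.Language

/-- Function symbols: the constant `0` of sort `R_0`, and, for the `n` indices `i : Fin n`,
`f_i : R_0 → R_i` and `g_i : R_i → R_0`. The sorts are `R_s` for `s : Fin (n + 1)`; the sorts other
than `R_0` are the `R_{i.succ}` with `i : Fin n`. -/
inductive Func (n : ℕ) : {k : ℕ} → (Fin k → Fin (n + 1)) → Fin (n + 1) → Type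
  | zero : Func n ![] 0
  | f (i : Fin n) : Func n ![0] i.succ
  | g (i : Fin n) : Func n ![i.succ] 0

/-- Relation symbols: `<_i` on the sort `R_i`. -/
inductive Rel (n : ℕ) : {k : ℕ} → (Fin k → Fin (n + 1)) → Type
  | lt (i : Fin n) : Rel n ![i.succ, i.succ]

/-- The `(n+1)`-sorted language `L_n^*`. -/
def lang (n : ℕ) : ManySorted.Language (Fin (n + 1)) where
  Func := Func n
  Rel := Rel n

section Symbols

variable {n : ℕ} {ι : Type} {σ : ι → Fin (n + 1)}

/-- The term `0`. -/
def zeroT : (lang n).Term σ 0 := .func (L := lang n) (Func.zero : Func n _ _) (fun j => j.elim0)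

/-- The term `f_i(t)`. -/
def fT (i : Fin n) (t : (lang n).Term σ 0) : (lang n).Term σ i.succ :=
  .func (L := lang n) (Func.f i : Func n _ _) (Fin.cons t (fun j => j.elim0))

/-- The term `g_i(t)`. -/
def gT (i : Fin n) (t : (lang n).Term σ i.succ) : (lang n).Term σ 0 :=
  .func (L := lang n) (Func.g i : Func n _ _) (Fin.cons t (fun j => j.elim0))

/-- The formula `t₁ <_i t₂`. -/
def ltF (i : Fin n) (t₁ t₂ : (lang n).Term σ i.succ) : (lang n).Formula σ :=
  .rel (L := lang n) (Rel.lt i : Rel n _) (Fin.cons t₁ (Fin.cons t₂ (fun j => j.elim0)))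

/-- The three most recently bound variables. -/
def v0 {s : Fin (n + 1)} : (lang n).Term (extend σ s) s :=
  .var (σ := extend σ s) none

def v1 {s s' : Fin (n + 1)} : (lang n).Term (extend (extend σ s) s') s :=
  .var (σ := extend (extend σ s) s') (some none)

def v2 {s s' s'' : Fin (n + 1)} : (lang n).Term (extend (extend (extend σ s) s') s'') s :=
  .var (σ := extend (extend (extend σ s) s') s'') (some (some none))

end Symbols

section Axioms

variable {n : ℕ}

open ManySorted.Language.Formula

/-- `¬ x <_i x`. -/
def axIrrefl (i : Fin n) : (lang n).Sentence := all i.succ (ltF i v0 v0).not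

/-- `x <_i y` and `y <_i z` imply `x <_i z`. -/
def axTrans (i : Fin n) : (lang n).Sentence :=
  all i.succ (all i.succ (all i.succ (((ltF i v2 v1).and (ltF i v1 v0)).imp (ltF i v2 v0))))

/-- `x <_i y` or `x = y` or `y <_i x`. -/
def axTotal (i : Fin n) : (lang n).Sentence :=
  all i.succ (all i.succ ((ltF i v1 v0).or ((eq v1 v0).or (ltF i v0 v1))))

/-- The order `<_i` is dense. -/
def axDense (i : Fin n) : (lang n).Sentence :=
  all i.succ (all i.succ ((ltF i v1 v0).imp
    (ex i.succ ((ltF i v2 v0).and (ltF i v0 v1)))))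

/-- The order `<_i` has no greatest element. -/
def axNoMax (i : Fin n) : (lang n).Sentence := all i.succ (ex i.succ (ltF i v1 v0))

/-- The order `<_i` has no least element. -/
def axNoMin (i : Fin n) : (lang n).Sentence := all i.succ (ex i.succ (ltF i v0 v1))

/-- `f_i` is injective. -/
def axInj (i : Fin n) : (lang n).Sentence :=
  all 0 (all 0 ((eq (fT i v1) (fT i v0)).imp (eq v1 v0)))

/-- `g_i` is the inverse of `f_i` on the image of `f_i`. -/
def axInv (i : Fin n) : (lang n).Sentence := all 0 (eq (gT i (fT i v0)) v0)

/-- `g_i` is `0` off the image of `f_i`. -/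
def axInvZero (i : Fin n) : (lang n).Sentence :=
  all i.succ ((ex 0 (eq (fT i v0) v1)).not.imp (eq (gT i v0) zeroT))

/-- The image of `f_i` is `<_i`-dense in `R_i`. -/
def axImageDense (i : Fin n) : (lang n).Sentence :=
  all i.succ (all i.succ ((ltF i v1 v0).imp
    (ex 0 ((ltF i v2 (fT i v0)).and (ltF i (fT i v0) v1)))))

/-- The complement of the image of `f_i` is `<_i`-dense in `R_i`. -/
def axImageCodense (i : Fin n) : (lang n).Sentence :=
  all i.succ (all i.succ ((ltF i v1 v0).imp
    (ex i.succ (((ltF i v2 v0).and (ltF i v0 v1)).and (ex 0 (eq (fT i v0) v1)).not))))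

/-- For all `a_1, …, a_n` and `b_1, …, b_n` with `a_i, b_i` of sort `R_i` and `a_i <_i b_i` for all
`i`, there is a single `x` of sort `R_0` such that `a_i <_i f_i(x) <_i b_i` for all `i`. -/
def axApprox (n : ℕ) : (lang n).Sentence :=
  let ρ : Fin n → Fin (n + 1) := Fin.succ
  let Γ : (Empty ⊕ Fin n) ⊕ Fin n → Fin (n + 1) := Sum.elim (Sum.elim (fun e => e.elim) ρ) ρ
  allBlock n ρ (allBlock n ρ (
    (conj ((List.finRange n).map fun i =>
      ltF i (.var (σ := Γ) (Sum.inl (Sum.inr i))) (.var (σ := Γ) (Sum.inr i)))).imp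
    (ex 0 (conj ((List.finRange n).map fun i =>
      (ltF i (.var (σ := extend Γ 0) (some (Sum.inl (Sum.inr i)))) (fT i v0)).and
        (ltF i (fT i v0) (.var (σ := extend Γ 0) (some (Sum.inr i)))))))))

end Axioms

/-- The theory `VO_n`. -/
def theory (n : ℕ) : (lang n).Theory :=
  {φ | φ = axApprox n ∨ ∃ i : Fin n,
    φ = axIrrefl i ∨ φ = axTrans i ∨ φ = axTotal i ∨ φ = axDense i ∨ φ = axNoMax i ∨
    φ = axNoMin i ∨ φ = axInj i ∨ φ = axInv i ∨ φ = axInvZero i ∨ φ = axImageDense i ∨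
    φ = axImageCodense i}

/-! #### The axioms, read in a structure -/

section Reading

variable {n : ℕ} (M : Fin (n + 1) → Type u) [(lang n).Structure M]

/-- The interpretation of `0`. -/
def zero : M 0 := Structure.funMap (L := lang n) (Func.zero : Func n _ _) (fun j => j.elim0)

variable {M}

/-- The interpretation of `f_i`. -/
def f (i : Fin n) (x : M 0) : M i.succ :=
  Structure.funMap (L := lang n) (Func.f i : Func n _ _) (Fin.cons x (fun j => j.elim0))

/-- The interpretation of `g_i`. -/
def g (i : Fin n) (y : M i.succ) : M 0 :=
  Structure.funMap (L := lang n) (Func.g i : Func n _ _) (Fin.cons y (fun j => j.elim0))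

/-- The interpretation of `<_i`. -/
def lt (i : Fin n) (x y : M i.succ) : Prop :=
  Structure.relMap (L := lang n) (Rel.lt i : Rel n _)
    (Fin.cons x (Fin.cons y (fun j => j.elim0)))

variable {ι : Type} {σ : ι → Fin (n + 1)} (v : ∀ i, M (σ i))

theorem realize_zeroT : (zeroT : (lang n).Term σ 0).realize v = zero M := by
  unfold zeroT zero Term.realize
  congr 1; funext j; exact j.elim0

theorem realize_fT (i : Fin n) (t : (lang n).Term σ 0) :
    (fT i t).realize v = f i (t.realize v) := by
  unfold fT f
  change Structure.funMap _ _ = _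
  congr 1; funext j; refine Fin.cases rfl (fun j => j.elim0) j

theorem realize_gT (i : Fin n) (t : (lang n).Term σ i.succ) :
    (gT i t).realize v = g i (t.realize v) := by
  unfold gT g
  change Structure.funMap _ _ = _
  congr 1; funext j; refine Fin.cases rfl (fun j => j.elim0) j

theorem realize_ltF (i : Fin n) (t₁ t₂ : (lang n).Term σ i.succ) :
    (ltF i t₁ t₂).Realize v ↔ lt i (t₁.realize v) (t₂.realize v) := by
  unfold ltF lt
  change Structure.relMap _ _ ↔ _
  refine iff_of_eq (congrArg _ ?_)
  funext j
  refine Fin.cases rfl (fun j => Fin.cases rfl (fun j => j.elim0) j) j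

end Reading

/-- The models of `VO_n`, with the axioms written out. -/
theorem models_iff {n : ℕ} (M : Fin (n + 1) → Type u) [(lang n).Structure M] :
    (theory n).Models M ↔
      (∀ a b : (∀ i : Fin n, M i.succ), (∀ i, lt i (a i) (b i)) →
        ∃ x : M 0, ∀ i, lt i (a i) (f i x) ∧ lt i (f i x) (b i)) ∧
      ∀ i : Fin n,
        (∀ x : M i.succ, ¬ lt i x x) ∧
        (∀ x y z : M i.succ, lt i x y ∧ lt i y z → lt i x z) ∧
        (∀ x y : M i.succ, lt i x y ∨ x = y ∨ lt i y x) ∧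
        (∀ x y : M i.succ, lt i x y → ∃ z, lt i x z ∧ lt i z y) ∧
        (∀ x : M i.succ, ∃ y, lt i x y) ∧
        (∀ x : M i.succ, ∃ y, lt i y x) ∧
        (∀ x y : M 0, f i x = f i y → x = y) ∧
        (∀ x : M 0, g i (f i x) = x) ∧
        (∀ y : M i.succ, (¬ ∃ x, f i x = y) → g i y = zero M) ∧
        (∀ a b : M i.succ, lt i a b → ∃ x, lt i a (f i x) ∧ lt i (f i x) b) ∧
        (∀ a b : M i.succ, lt i a b → ∃ y, (lt i a y ∧ lt i y b) ∧ ¬ ∃ x, f i x = y) := by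
  have h1 : (theory n).Models M ↔ (axApprox n).Realize (fun e : Empty => (e.elim : M e.elim)) ∧
      ∀ i : Fin n, ∀ φ ∈ [axIrrefl i, axTrans i, axTotal i, axDense i, axNoMax i, axNoMin i,
        axInj i, axInv i, axInvZero i, axImageDense i, axImageCodense i],
        φ.Realize (fun e : Empty => (e.elim : M e.elim)) := by
    constructor
    · intro h
      refine ⟨h _ (Or.inl rfl), fun i φ hφ => h _ (Or.inr ⟨i, ?_⟩)⟩
      simpa using hφ
    · rintro ⟨h, h'⟩ φ (rfl | ⟨i, hi⟩)
      · exact h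
      · exact h' i φ (by simpa using hi)
  rw [h1]
  refine and_congr ?_ (forall_congr' fun i => ?_)
  · simp only [axApprox, Formula.realize_allBlock, Formula.Realize, Formula.realize_ex,
      Formula.realize_conj, List.mem_map, List.mem_finRange, true_and, forall_exists_index,
      forall_apply_eq_imp_iff, Formula.realize_and]
    refine forall_congr' fun a => forall_congr' fun b => imp_congr
      (forall_congr' fun i => realize_ltF _ i _ _)
      (exists_congr fun x => forall_congr' fun i => and_congr ?_ ?_)
    · refine (realize_ltF _ i _ _).trans ?_
      rw [realize_fT]; rfl
    · refine (realize_ltF _ i _ _).trans ?_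
      rw [realize_fT]; rfl
  · simp only [List.forall_mem_cons, List.not_mem_nil, false_imp_iff, implies_true, and_true,
      axIrrefl, axTrans, axTotal, axDense, axNoMax, axNoMin, axInj, axInv, axInvZero,
      axImageDense, axImageCodense, Formula.Realize, Formula.realize_not, Formula.realize_or,
      Formula.realize_and, Formula.realize_ex, realize_ltF, realize_fT, realize_gT, realize_zeroT]
    rfl

end VO

namespace VO

open ManySorted ManySorted.Language

set_option linter.unusedSectionVars false

/-! Every element has a coordinate in each `R_j`, with `f_j(0)` as trivial value. Nonzero elements
of `R_0` and their images have only nontrivial coordinates; an element outside the images has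
exactly one. Elements sharing a nontrivial coordinate therefore share all of them
(`coord_eq_of_coord_apply_eq`), and the nontrivial coordinates of an element can be moved at once
into arbitrary nonempty cuts (`exists_coord_in_cut`: axiom 5 for images, codensity for the others).
Back-and-forth then shows that the order pattern of the coordinates, together with the list of
entries that are images, determines the complete type of a finite tuple (`SameType.realize_iff`); a
single formula isolates this type.

Define a class `X` by `ψ(x, c)` with as few parameters as possible. If another tuple `c'` also gives
`ψ(M, c') = X`, every entry of `c` has the coordinates of an entry of `c'`
(`exists_coord_eq_of_minimal`). Otherwise some `c l` could be moved slightly, in any direction,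
without changing its type over `c'` and the other entries, hence without changing the set defined.
Whether `c` and a modified tuple define the same set depends only on their joint type, so "slightly"
can be dropped: replacing `c l` by any element with the same type over the other entries preserves
`X`. That entry can then be quantified away, against minimality.

So `c'` is a permutation of `c` up to coordinates. Adding the type of `c` to `ψ` forces the
permutation to preserve order in every coordinate, which gives `c' = c`
(`eq_of_sameType_of_minimal`). -/

/-- A structure satisfying the axioms of `VO_n` for some `n ≥ 1`. -/
class IsModel {n : ℕ} (M : Fin (n + 1) → Type u) [(lang n).Structure M] : Prop where
  pos : 1 ≤ n
  models : (theory n).Models M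

/-! ### Coordinates of elements -/

section Coordinates

variable {n : ℕ} {M : Fin (n + 1) → Type u} [(lang n).Structure M] [IsModel M]

theorem exists_f_between (a b : ∀ i : Fin n, M i.succ) (h : ∀ i, lt i (a i) (b i)) :
    ∃ x : M 0, ∀ i, lt i (a i) (f i x) ∧ lt i (f i x) (b i) :=
  ((models_iff M).1 IsModel.models).1 a b h

open Classical in
noncomputable instance instLinearOrder (i : Fin n) : LinearOrder (M i.succ) :=
  have h := ((models_iff M).1 IsModel.models).2 i
  haveI : IsStrictTotalOrder (M i.succ) (lt i) :=
    { irrefl := h.1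
      trans := fun x y z hxy hyz => h.2.1 x y z ⟨hxy, hyz⟩
      trichotomous := fun x y hxy hyx => ((h.2.2.1 x y).resolve_left hxy).resolve_right hyx }
  linearOrderOfSTO (lt i)

instance instDenselyOrdered (i : Fin n) : DenselyOrdered (M i.succ) where
  dense x y h := (((models_iff M).1 IsModel.models).2 i).2.2.2.1 x y h

instance instNoMaxOrder (i : Fin n) : NoMaxOrder (M i.succ) where
  exists_gt x := (((models_iff M).1 IsModel.models).2 i).2.2.2.2.1 x

instance instNoMinOrder (i : Fin n) : NoMinOrder (M i.succ) where
  exists_lt x := (((models_iff M).1 IsModel.models).2 i).2.2.2.2.2.1 x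

instance instNonempty (i : Fin n) : Nonempty (M i.succ) := ⟨f i (zero M)⟩

theorem f_injective (i : Fin n) : Function.Injective (f i : M 0 → M i.succ) :=
  fun x y h => (((models_iff M).1 IsModel.models).2 i).2.2.2.2.2.2.1 x y h

theorem g_f (i : Fin n) (x : M 0) : g i (f i x) = x :=
  (((models_iff M).1 IsModel.models).2 i).2.2.2.2.2.2.2.1 x

theorem g_of_forall_ne (i : Fin n) (y : M i.succ) (h : ¬ ∃ x, f i x = y) : g i y = zero M :=
  (((models_iff M).1 IsModel.models).2 i).2.2.2.2.2.2.2.2.1 y h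

theorem exists_not_f_between (i : Fin n) (a b : M i.succ) (h : a < b) :
    ∃ y, (a < y ∧ y < b) ∧ ¬ ∃ x, f i x = y :=
  (((models_iff M).1 IsModel.models).2 i).2.2.2.2.2.2.2.2.2.2 a b h

open Classical in
/-- The `j`-th coordinate of an element: an element of `R_j` is its own `j`-th coordinate, and the
other coordinates are the values of `f_j` at the associated element of `R_0`. -/
noncomputable def coord {s : Fin (n + 1)} (x : M s) (j : Fin n) : M j.succ :=
  Fin.cases (motive := fun s => M s → M j.succ) (fun x => f j x)
    (fun k y => if h : k = j then h ▸ y else f j (g k y)) s x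

theorem coord_zero (x : M 0) (j : Fin n) : coord x j = f j x := rfl

theorem coord_self {k : Fin n} (y : M k.succ) : coord y k = y := by
  simp [coord]

theorem coord_of_ne {k j : Fin n} (h : k ≠ j) (y : M k.succ) : coord y j = f j (g k y) := by
  simp [coord, h]

/-- The element has the coordinates of an element of `R_0`. -/
def IsImage {s : Fin (n + 1)} (x : M s) : Prop := ∃ z : M 0, coord z = coord x

theorem coord_injective {s : Fin (n + 1)} :
    Function.Injective (coord : M s → ∀ j : Fin n, M j.succ) := by
  intro x y h
  induction s using Fin.cases with
  -- This is where `n ≥ 1` matters: an element of `R_0` is recovered from any one coordinate, so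
  -- there must be one.
  | zero => exact f_injective (M := M) ⟨0, IsModel.pos M⟩ (congrFun h ⟨0, IsModel.pos M⟩)
  | succ k => simpa only [coord_self] using congrFun h k

theorem coord_f (k : Fin n) (z : M 0) : coord (f k z) = coord z := by
  funext j
  by_cases h : k = j
  · subst h; rw [coord_self, coord_zero]
  · rw [coord_of_ne h, g_f, coord_zero]

theorem exists_coord_eq (s : Fin (n + 1)) (z : M 0) : ∃ y : M s, coord y = coord z := by
  induction s using Fin.cases with
  | zero => exact ⟨z, rfl⟩
  | succ k => exact ⟨f k z, coord_f k z⟩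

theorem IsImage.exists_f {s : Fin (n + 1)} {x : M s} (h : IsImage x) (j : Fin n) :
    ∃ z, f j z = coord x j := by
  obtain ⟨z, hz⟩ := h
  exact ⟨z, congrFun hz j⟩

/-- An element is either in the image of `R_0`, or it is an element of some `R_k` whose
coordinates other than the `k`-th one are trivial. -/
theorem isImage_or {s : Fin (n + 1)} (x : M s) : IsImage x ∨ ∃ k : Fin n, s = k.succ ∧
    (¬ ∃ z, f k z = coord x k) ∧ ∀ j, j ≠ k → coord x j = coord (zero M) j := by
  induction s using Fin.cases with
  | zero => exact Or.inl ⟨x, rfl⟩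
  | succ k =>
    by_cases h : ∃ z, f k z = x
    · obtain ⟨z, rfl⟩ := h
      exact Or.inl ⟨z, (coord_f k z).symm⟩
    · refine Or.inr ⟨k, rfl, by rwa [coord_self], fun j hj => ?_⟩
      rw [coord_of_ne hj.symm, g_of_forall_ne k x h, coord_zero]

/-- Elements which share a nontrivial coordinate share all coordinates. -/
theorem coord_eq_of_coord_apply_eq {s t : Fin (n + 1)} {x : M s} {y : M t} {j : Fin n}
    (h₀ : coord x j ≠ coord (zero M) j) (h : coord x j = coord y j) : coord x = coord y := by
  rcases isImage_or x with hx | ⟨k, -, hxk, hx⟩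
  · rcases isImage_or y with hy | ⟨l, -, hyl, hy⟩
    · obtain ⟨z, hz⟩ := hx
      obtain ⟨z', hz'⟩ := hy
      rw [← hz, ← hz'] at h ⊢
      rw [f_injective j h]
    · by_cases hj : j = l
      · subst hj
        exact absurd (h ▸ hx.exists_f j) hyl
      · exact absurd (h.trans (hy j hj)) h₀
  · by_cases hj : j = k
    · subst hj
      rcases isImage_or y with hy | ⟨l, -, hyl, hy⟩
      · exact absurd (h ▸ hy.exists_f j) hxk
      · by_cases hjl : j = l
        · subst hjl
          funext i
          by_cases hi : i = j
          · subst hi; exact h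
          · rw [hx i hi, hy i hi]
        · exact absurd (h.trans (hy j hjl)) h₀
    · exact absurd (hx j hj) h₀

/-- A non-image element lies in the `R_k` for which its `k`-th coordinate is outside `f_k(R_0)`; all
its other coordinates are those of `0`. For images this fails, since their coordinates are realized
in every sort. -/
theorem sort_eq_of_coord_eq {s t : Fin (n + 1)} {x : M s} {y : M t} (hx : ¬ IsImage x)
    (h : coord x = coord y) : s = t := by
  obtain ⟨k, rfl, hxk, -⟩ := (isImage_or x).resolve_left hx
  have hy : ¬ IsImage y := fun ⟨z, hz⟩ => hx ⟨z, hz.trans h.symm⟩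
  obtain ⟨l, rfl, -, hy⟩ := (isImage_or y).resolve_left hy
  by_cases hkl : k = l
  · rw [hkl]
  · exact absurd ⟨zero M, by rw [h, hy k hkl, coord_zero]⟩ hxk

/-! ### Realizing cuts -/

/-- A whole interval inside the cut is needed, not just a point: the density axioms then supply an
element of the required kind in it. -/
theorem exists_lt_between_sets {α : Type*} [LinearOrder α] [DenselyOrdered α] [NoMinOrder α]
    [NoMaxOrder α] [Nonempty α] {L U : Set α} (hL : L.Finite) (hU : U.Finite)
    (h : ∀ a ∈ L, ∀ b ∈ U, a < b) :
    ∃ a b, a < b ∧ (∀ c ∈ L, c < a) ∧ ∀ c ∈ U, b < c := by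
  obtain ⟨a, ha, ha'⟩ := Order.exists_between_finsets (α := α) hL.toFinset hU.toFinset
    (by simpa using h)
  obtain ⟨b, hb, hbU⟩ := Order.exists_between_finsets (α := α) {a} hU.toFinset
    (by simpa using ha')
  exact ⟨a, b, by simpa using hb, by simpa using ha, by simpa using hbU⟩

/-- The nontrivial coordinates of `x` can be moved into any prescribed nonempty cuts. -/
theorem exists_coord_in_cut {s : Fin (n + 1)} (x : M s) (hx : coord x ≠ coord (zero M))
    (L U : ∀ j : Fin n, Set (M j.succ)) (hL : ∀ j, (L j).Finite) (hU : ∀ j, (U j).Finite)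
    (h : ∀ j, ∀ a ∈ L j, ∀ b ∈ U j, a < b) :
    ∃ y : M s, (IsImage x ↔ IsImage y) ∧ ∀ j,
      (coord x j = coord (zero M) j → coord y j = coord (zero M) j) ∧
      (coord x j ≠ coord (zero M) j →
        (∀ a ∈ L j, a < coord y j) ∧ ∀ b ∈ U j, coord y j < b) := by
  choose a b hab ha hb using fun j => exists_lt_between_sets (hL j) (hU j) (h j)
  rcases isImage_or x with hx' | ⟨k, rfl, hxk, hx'⟩
  · obtain ⟨z, hz⟩ := exists_f_between a b hab
    obtain ⟨y, hy⟩ := exists_coord_eq s z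
    refine ⟨y, iff_of_true hx' ⟨z, hy.symm⟩, fun j => ⟨fun h0 => ?_, fun _ => ?_⟩⟩
    -- An image with one trivial coordinate has all coordinates trivial, by injectivity of `f j`.
    · refine absurd ?_ hx
      obtain ⟨w, hw⟩ := hx'
      rw [← hw] at h0 ⊢
      rw [f_injective j h0]
    · rw [hy, coord_zero]
      exact ⟨fun c hc => (ha j c hc).trans (hz j).1,
        fun c hc => lt_trans (show f j z < b j from (hz j).2) (hb j c hc)⟩
  · obtain ⟨y, hy, hyk⟩ := exists_not_f_between k (a k) (b k) (hab k)
    have hyI : ¬ IsImage y := fun hI => hyk (by simpa only [coord_self] using hI.exists_f k)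
    refine ⟨y, iff_of_false (fun hI => hxk (hI.exists_f k)) hyI, fun j => ?_⟩
    by_cases hj : j = k
    · subst hj
      refine ⟨fun h0 => absurd ⟨zero M, h0.symm⟩ hxk, fun _ => ?_⟩
      rw [coord_self]
      exact ⟨fun c hc => (ha j c hc).trans hy.1, fun c hc => hy.2.trans (hb j c hc)⟩
    · refine ⟨fun _ => ?_, fun h0 => absurd (hx' j hj) h0⟩
      rw [coord_of_ne (Ne.symm hj), g_of_forall_ne k y hyk, coord_zero]

/-! ### Tuples with the same order pattern -/

/-- The coordinates of the members of a tuple, and those of `0` for the index `none`. -/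
noncomputable def tupleCoord {ι : Type} {σ : ι → Fin (n + 1)} (v : ∀ i, M (σ i)) :
    Option ι → ∀ j : Fin n, M j.succ
  | none => coord (zero M)
  | some i => coord (v i)

/-- Two tuples have the same type: their coordinates are ordered in the same way, and the same
members are in the image of `R_0`. -/
structure SameType {ι : Type} {σ : ι → Fin (n + 1)} (v w : ∀ i, M (σ i)) : Prop where
  lt_iff : ∀ (o o' : Option ι) (j : Fin n),
    tupleCoord v o j < tupleCoord v o' j ↔ tupleCoord w o j < tupleCoord w o' j
  isImage_iff : ∀ i, IsImage (v i) ↔ IsImage (w i)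

variable {ι : Type} {σ : ι → Fin (n + 1)} {v w : ∀ i, M (σ i)}

theorem SameType.refl (v : ∀ i, M (σ i)) : SameType v v := ⟨fun _ _ _ => Iff.rfl, fun _ => Iff.rfl⟩

theorem SameType.symm (h : SameType v w) : SameType w v :=
  ⟨fun o o' j => (h.lt_iff o o' j).symm, fun i => (h.isImage_iff i).symm⟩

theorem SameType.eq_iff (h : SameType v w) (o o' : Option ι) (j : Fin n) :
    tupleCoord v o j = tupleCoord v o' j ↔ tupleCoord w o j = tupleCoord w o' j := by
  simp only [eq_iff_le_not_lt, ← not_lt, h.lt_iff]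

theorem exists_coord_eq_tupleCoord (v : ∀ i, M (σ i)) (o : Option ι) :
    ∃ (s : Fin (n + 1)) (y : M s), coord y = tupleCoord v o := by
  cases o with
  | none => exact ⟨0, zero M, rfl⟩
  | some i => exact ⟨σ i, v i, rfl⟩

theorem SameType.extendVal {s : Fin (n + 1)} {x y : M s} (h : SameType v w)
    (hI : IsImage x ↔ IsImage y)
    (h₁ : ∀ o j, tupleCoord v o j < coord x j ↔ tupleCoord w o j < coord y j)
    (h₂ : ∀ o j, coord x j < tupleCoord v o j ↔ coord y j < tupleCoord w o j) :
    SameType (Language.extendVal v x) (Language.extendVal w y) := by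
  refine ⟨?_, ?_⟩
  · rintro (_ | _ | i) (_ | _ | i') j
    · exact h.lt_iff none none j
    · exact h₁ none j
    · exact h.lt_iff none (some i') j
    · exact h₂ none j
    · exact iff_of_false (lt_irrefl _) (lt_irrefl _)
    · exact h₂ (some i') j
    · exact h.lt_iff (some i) none j
    · exact h₁ (some i) j
    · exact h.lt_iff (some i) (some i') j
  · rintro (_ | i)
    · exact hI
    · exact h.isImage_iff i

/-- The back-and-forth property. -/
theorem SameType.exists_extendVal [Finite ι] (h : SameType v w) {s : Fin (n + 1)} (x : M s) :
    ∃ y : M s, SameType (Language.extendVal v x) (Language.extendVal w y) := by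
  -- Either `x` is interdefinable with `0` or an entry of `v`, and its counterpart is forced, or it
  -- is fresh and goes into the corresponding cuts over `w`.
  by_cases hx : ∃ o, coord x = tupleCoord v o
  · obtain ⟨o, ho⟩ := hx
    suffices ∃ y : M s, (IsImage x ↔ IsImage y) ∧ coord y = tupleCoord w o by
      obtain ⟨y, hI, hy⟩ := this
      refine ⟨y, h.extendVal hI ?_ ?_⟩ <;> intro o' j <;> rw [ho, hy] <;> exact h.lt_iff _ _ _
    by_cases hxI : IsImage x
    · have : ∃ z : M 0, coord z = tupleCoord w o := by
        cases o with
        | none => exact ⟨zero M, rfl⟩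
        | some i =>
          refine (h.isImage_iff i).1 ?_
          obtain ⟨z, hz⟩ := hxI
          exact ⟨z, hz.trans ho⟩
      obtain ⟨z, hz⟩ := this
      obtain ⟨y, hy⟩ := exists_coord_eq s z
      exact ⟨y, iff_of_true hxI ⟨z, hy.symm⟩, hy.trans hz⟩
    · cases o with
      | none => exact absurd ⟨zero M, ho.symm⟩ hxI
      | some i =>
        change coord x = coord (v i) at ho
        have hs := sort_eq_of_coord_eq hxI ho
        subst hs
        refine ⟨w i, ?_, rfl⟩
        rw [← h.isImage_iff i, coord_injective ho]
  · push Not at hx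
    obtain ⟨y, hI, hy⟩ := exists_coord_in_cut x (hx none)
      (fun j => Set.image (fun o => tupleCoord w o j) {o | tupleCoord v o j < coord x j})
      (fun j => Set.image (fun o => tupleCoord w o j) {o | coord x j < tupleCoord v o j})
      (fun j => (Set.toFinite _).image _) (fun j => (Set.toFinite _).image _)
      (by
        rintro j _ ⟨o, ho, rfl⟩ _ ⟨o', ho', rfl⟩
        exact (h.lt_iff o o' j).1 (lt_trans ho ho'))
    have key : ∀ o j, (tupleCoord v o j < coord x j ↔ tupleCoord w o j < coord y j) ∧
        (coord x j < tupleCoord v o j ↔ coord y j < tupleCoord w o j) := by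
      intro o j
      by_cases h0 : coord x j = coord (zero M) j
      -- A trivial coordinate behaves like the entry `none` of the tuple.
      · rw [(hy j).1 h0, h0]
        exact ⟨h.lt_iff o none j, h.lt_iff none o j⟩
      · have hc := (hy j).2 h0
        have hne : coord x j ≠ tupleCoord v o j := by
          obtain ⟨t, u, hu⟩ := exists_coord_eq_tupleCoord v o
          intro he
          exact hx o ((coord_eq_of_coord_apply_eq h0 (he.trans (by rw [hu]))).trans hu)
        rcases lt_or_gt_of_ne hne with hlt | hlt
        · have := hc.2 _ ⟨o, hlt, rfl⟩
          exact ⟨iff_of_false hlt.not_gt this.not_gt, iff_of_true hlt this⟩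
        · have := hc.1 _ ⟨o, hlt, rfl⟩
          exact ⟨iff_of_true hlt this, iff_of_false hlt.not_gt this.not_gt⟩
    exact ⟨y, h.extendVal hI (fun o j => (key o j).1) (fun o j => (key o j).2)⟩

/-! ### Moving a single entry -/

/-- An element `x` can be moved within a small neighbourhood avoiding finitely many other elements,
in any direction taken by another element `z` of the same kind. -/
theorem exists_near {s : Fin (n + 1)} {x z : M s} (hne : z ≠ x) [Finite ι]
    (h0 : coord x ≠ coord (zero M)) (hz : ∀ j, coord x j = coord (zero M) j →
      coord z j = coord (zero M) j) (p : ι → ∀ j : Fin n, M j.succ)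
    (hp : ∀ i, ∃ (t : Fin (n + 1)) (y : M t), coord y = p i) (hxp : ∀ i, coord x ≠ p i) :
    ∃ y : M s, (IsImage x ↔ IsImage y) ∧
      (∀ j, coord x j = coord (zero M) j → coord y j = coord (zero M) j) ∧
      (∀ i j, coord x j ≠ coord (zero M) j →
        ((p i j < coord x j ↔ p i j < coord y j) ∧ (coord x j < p i j ↔ coord y j < p i j))) ∧
      ∀ j, (coord x j < coord y j ↔ coord x j < coord z j) ∧
        (coord y j < coord x j ↔ coord z j < coord x j) := by
  obtain ⟨y, hI, hy⟩ := exists_coord_in_cut x h0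
    -- The point `coord x j` itself is put below or above the cut, according to the side on which
    -- `coord z j` lies; this fixes the direction of the move.
    (fun j => Set.image (fun i => p i j) {i | p i j < coord x j} ∪ {a | a = coord x j ∧ a < coord z j})
    (fun j => Set.image (fun i => p i j) {i | coord x j < p i j} ∪ {a | a = coord x j ∧ coord z j < a})
    (fun j => ((Set.toFinite _).image _).union
      ((Set.finite_singleton (coord x j)).subset fun a ha => ha.1))
    (fun j => ((Set.toFinite _).image _).union
      ((Set.finite_singleton (coord x j)).subset fun a ha => ha.1))
    (by
      rintro j _ (⟨i, hi, rfl⟩ | ⟨rfl, hi⟩) _ (⟨i', hi', rfl⟩ | ⟨rfl, hi'⟩)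
      · exact lt_trans hi hi'
      · exact hi
      · exact hi'
      · exact absurd hi hi'.not_gt)
  refine ⟨y, hI, fun j => (hy j).1, fun i j hj => ?_, fun j => ?_⟩
  · have hc := (hy j).2 hj
    have hne : coord x j ≠ p i j := by
      obtain ⟨t, u, hu⟩ := hp i
      intro he
      exact hxp i ((coord_eq_of_coord_apply_eq hj (he.trans (by rw [hu]))).trans hu)
    rcases lt_or_gt_of_ne hne with hlt | hlt
    · have := hc.2 _ (Or.inl ⟨i, hlt, rfl⟩)
      exact ⟨iff_of_false hlt.not_gt this.not_gt, iff_of_true hlt this⟩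
    · have := hc.1 _ (Or.inl ⟨i, hlt, rfl⟩)
      exact ⟨iff_of_true hlt this, iff_of_false hlt.not_gt this.not_gt⟩
  · by_cases hj : coord x j = coord (zero M) j
    · rw [(hy j).1 hj, hz j hj, hj]
      exact ⟨Iff.rfl, Iff.rfl⟩
    · have hc := (hy j).2 hj
      have hne : coord x j ≠ coord z j := fun he =>
        hne (coord_injective (coord_eq_of_coord_apply_eq hj he)).symm
      rcases lt_or_gt_of_ne hne with hlt | hlt
      · have := hc.1 _ (Or.inr ⟨rfl, hlt⟩)
        exact ⟨iff_of_true this hlt, iff_of_false this.not_gt hlt.not_gt⟩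
      · have := hc.2 _ (Or.inr ⟨rfl, hlt⟩)
        exact ⟨iff_of_false this.not_gt hlt.not_gt, iff_of_true this hlt⟩

open Function in
theorem tupleCoord_update_of_ne [DecidableEq ι] (u : ∀ i, M (σ i)) (i : ι) (z : M (σ i))
    {o : Option ι} (ho : o ≠ some i) :
    tupleCoord (σ := σ) (update u i z) o = tupleCoord u o := by
  cases o with
  | none => rfl
  | some k =>
    have : k ≠ i := fun h => ho (congrArg some h)
    simp [tupleCoord, this]

open Function in
theorem tupleCoord_update_self [DecidableEq ι] (u : ∀ i, M (σ i)) (i : ι) (z : M (σ i)) :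
    tupleCoord (σ := σ) (update u i z) (some i) = coord z := by
  simp [tupleCoord]

open Function in
theorem sameType_update [DecidableEq ι] (u : ∀ i, M (σ i)) (i : ι) {x y : M (σ i)}
    (hI : IsImage x ↔ IsImage y)
    (h : ∀ o : Option ι, o ≠ some i → ∀ j,
      (tupleCoord u o j < coord x j ↔ tupleCoord u o j < coord y j) ∧
      (coord x j < tupleCoord u o j ↔ coord y j < tupleCoord u o j)) :
    SameType (σ := σ) (update u i x) (update u i y) := by
  refine ⟨fun o o' j => ?_, fun k => ?_⟩
  · by_cases ho : o = some i <;> by_cases ho' : o' = some i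
    · subst ho ho'; simp only [lt_irrefl]
    · subst ho; simp only [tupleCoord_update_self, tupleCoord_update_of_ne _ _ _ ho', (h o' ho' j).2]
    · subst ho'; simp only [tupleCoord_update_self, tupleCoord_update_of_ne _ _ _ ho, (h o ho j).1]
    · simp only [tupleCoord_update_of_ne _ _ _ ho, tupleCoord_update_of_ne _ _ _ ho']
  · by_cases hk : k = i
    · subst hk; simpa using hI
    · simp [hk]

/-! ### Formulas and types -/

open Classical in
-- For `y` outside the image, the coordinates other than the `k`-th are already trivial, so `g k`
-- only resets the `k`-th. On the image it changes no coordinate.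
theorem coord_g (k : Fin n) (y : M k.succ) (j : Fin n) :
    coord (g k y) j = if j = k ∧ ¬ IsImage y then coord (zero M) j else coord y j := by
  by_cases hj : k = j
  · subst hj
    by_cases hy : ∃ z, f k z = y
    · obtain ⟨z, rfl⟩ := hy
      rw [if_neg fun h => h.2 ⟨z, (coord_f k z).symm⟩, g_f, coord_f]
    · rw [if_pos ⟨rfl, fun hI => hy (by simpa only [coord_self] using hI.exists_f k)⟩,
        g_of_forall_ne k y hy]
  · rw [if_neg fun h => hj h.1.symm, coord_of_ne hj, coord_zero]

/-- Function symbols create no new coordinates: they copy them or reset one to that of `0`. Which of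
the two happens depends only on being an image, so the same index `o` serves both tuples. -/
theorem SameType.term_realize (h : SameType v w) {s : Fin (n + 1)} (t : (lang n).Term σ s) :
    (IsImage (t.realize v) ↔ IsImage (t.realize w)) ∧
    ∀ j, ∃ o, coord (t.realize v) j = tupleCoord v o j ∧
      coord (t.realize w) j = tupleCoord w o j := by
  induction t with
  | var i => exact ⟨h.isImage_iff i, fun j => ⟨some i, rfl, rfl⟩⟩
  | func F ts ih =>
    change Func n _ _ at F
    cases F with
    | zero =>
      have hr : Term.func (L := lang n) (Func.zero : Func n _ _) ts = zeroT := by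
        unfold zeroT
        congr 1; funext j; exact j.elim0
      rw [hr, realize_zeroT, realize_zeroT]
      exact ⟨Iff.rfl, fun j => ⟨none, rfl, rfl⟩⟩
    | f i =>
      obtain ⟨t, rfl⟩ : ∃ t : (lang n).Term σ 0,
          ts = Fin.cons (α := fun j => (lang n).Term σ (![0] j)) t (fun j => j.elim0) :=
        ⟨ts 0, funext fun j => Fin.cases rfl (fun j => j.elim0) j⟩
      change (IsImage ((fT i t).realize v) ↔ IsImage ((fT i t).realize w)) ∧ ∀ j, ∃ o,
        coord ((fT i t).realize v) j = _ ∧ coord ((fT i t).realize w) j = _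
      rw [realize_fT, realize_fT]
      refine ⟨iff_of_true ⟨_, (coord_f i _).symm⟩ ⟨_, (coord_f i _).symm⟩, fun j => ?_⟩
      rw [coord_f, coord_f]
      exact (ih 0).2 j
    | g i =>
      obtain ⟨t, rfl⟩ : ∃ t : (lang n).Term σ i.succ, ts = Fin.cons t (fun j => j.elim0) :=
        ⟨ts 0, funext fun j => Fin.cases rfl (fun j => j.elim0) j⟩
      change (IsImage ((gT i t).realize v) ↔ IsImage ((gT i t).realize w)) ∧ ∀ j, ∃ o,
        coord ((gT i t).realize v) j = _ ∧ coord ((gT i t).realize w) j = _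
      rw [realize_gT, realize_gT]
      refine ⟨iff_of_true ⟨_, rfl⟩ ⟨_, rfl⟩, fun j => ?_⟩
      have hI : IsImage (t.realize v) ↔ IsImage (t.realize w) := (ih 0).1
      rw [coord_g, coord_g]
      by_cases hj : j = i ∧ ¬ IsImage (t.realize v)
      · rw [if_pos hj, if_pos ⟨hj.1, fun h' => hj.2 (hI.2 h')⟩]
        exact ⟨none, rfl, rfl⟩
      · rw [if_neg hj, if_neg fun h' => hj ⟨h'.1, fun hv => h'.2 (hI.1 hv)⟩]
        exact (ih 0).2 j

/-- Formulas do not distinguish tuples of the same type. -/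
theorem SameType.realize_iff (φ : (lang n).Formula σ) :
    ∀ [Finite ι] {v w : ∀ i, M (σ i)}, SameType v w → (φ.Realize v ↔ φ.Realize w) := by
  induction φ with
  | falsum => intros; exact Iff.rfl
  | eq t₁ t₂ =>
    intro _ v w h
    simp only [Formula.Realize, ← coord_injective.eq_iff (a := Term.realize _ t₁), funext_iff]
    refine forall_congr' fun j => ?_
    obtain ⟨o₁, h₁, h₁'⟩ := (h.term_realize t₁).2 j
    obtain ⟨o₂, h₂, h₂'⟩ := (h.term_realize t₂).2 j
    rw [h₁, h₁', h₂, h₂', h.eq_iff]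
  | @rel _ σ _ _ R ts =>
    intro _ v w h
    change Rel n _ at R
    cases R with
    | lt i =>
      obtain ⟨t₁, t₂, rfl⟩ : ∃ t₁ t₂ : (lang n).Term σ i.succ,
          ts = Fin.cons t₁ (Fin.cons t₂ (fun j => j.elim0)) :=
        ⟨ts 0, ts 1, funext fun j =>
          Fin.cases rfl (fun j => Fin.cases rfl (fun j => j.elim0) j) j⟩
      change (ltF i t₁ t₂).Realize v ↔ (ltF i t₁ t₂).Realize w
      rw [realize_ltF, realize_ltF]
      change t₁.realize v < t₂.realize v ↔ t₁.realize w < t₂.realize w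
      obtain ⟨o₁, h₁, h₁'⟩ := (h.term_realize t₁).2 i
      obtain ⟨o₂, h₂, h₂'⟩ := (h.term_realize t₂).2 i
      rw [coord_self] at h₁ h₁' h₂ h₂'
      rw [h₁, h₁', h₂, h₂', h.lt_iff]
  | imp φ ψ h₁ h₂ => intro _ v w h; exact imp_congr (h₁ h) (h₂ h)
  | all s φ ih =>
    intro _ v w h
    constructor
    · intro hv y
      obtain ⟨x, hx⟩ := h.symm.exists_extendVal y
      exact (ih hx).2 (hv x)
    · intro hw x
      obtain ⟨y, hy⟩ := h.exists_extendVal x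
      exact (ih hy).2 (hw y)

/-! ### Isolating types -/

/-- The set of tuples is defined by a formula without parameters. -/
def IsDefinable (A : (∀ i, M (σ i)) → Prop) : Prop :=
  ∃ φ : (lang n).Formula σ, ∀ v, φ.Realize v ↔ A v

theorem IsDefinable.and {A B : (∀ i, M (σ i)) → Prop} (hA : IsDefinable A) (hB : IsDefinable B) :
    IsDefinable fun v => A v ∧ B v := by
  obtain ⟨φ, hφ⟩ := hA
  obtain ⟨ψ, hψ⟩ := hB
  exact ⟨φ.and ψ, fun v => by rw [Formula.realize_and, hφ, hψ]⟩

theorem IsDefinable.forall {κ : Type*} [Finite κ] {A : κ → (∀ i, M (σ i)) → Prop}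
    (hA : ∀ k, IsDefinable (A k)) : IsDefinable fun v => ∀ k, A k v := by
  have := Fintype.ofFinite κ
  choose φ hφ using hA
  exact ⟨Formula.conj (Finset.univ.toList.map φ), fun v => by
    simp [Formula.realize_conj, hφ]⟩

theorem IsDefinable.iff_left {A : (∀ i, M (σ i)) → Prop} (hA : IsDefinable A) (p : Prop) :
    IsDefinable fun v => p ↔ A v := by
  obtain ⟨φ, hφ⟩ := hA
  by_cases hp : p
  · exact ⟨φ, fun v => by simp [hφ, hp]⟩
  · exact ⟨φ.not, fun v => by simp [Formula.realize_not, hφ, hp]⟩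

theorem exists_term_coord {s : Fin (n + 1)} (t : (lang n).Term σ s) (j : Fin n) :
    ∃ u : (lang n).Term σ j.succ, ∀ v : ∀ i, M (σ i), u.realize v = coord (t.realize v) j := by
  induction s using Fin.cases with
  | zero => exact ⟨fT j t, fun v => by rw [realize_fT, coord_zero]⟩
  | succ k =>
    by_cases h : k = j
    · subst h; exact ⟨t, fun v => by rw [coord_self]⟩
    · exact ⟨fT j (gT k t), fun v => by rw [realize_fT, realize_gT, coord_of_ne h]⟩

theorem exists_term_tupleCoord (o : Option ι) (j : Fin n) :
    ∃ u : (lang n).Term σ j.succ, ∀ v : ∀ i, M (σ i), u.realize v = tupleCoord v o j := by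
  cases o with
  | none => exact ⟨fT j zeroT, fun v => by rw [realize_fT, realize_zeroT]; rfl⟩
  | some i => exact exists_term_coord (.var i) j

theorem isDefinable_isImage (i : ι) : IsDefinable fun v : ∀ i, M (σ i) => IsImage (v i) := by
  choose u hu using exists_term_coord (M := M) (.var (some i) : (lang n).Term (extend σ 0) (σ i))
  obtain ⟨φ, hφ⟩ := IsDefinable.forall (M := M) (σ := extend σ 0)
    (A := fun j v => f j (v none) = coord (v (some i)) j)
    (fun j => ⟨.eq (fT j v0) (u j), fun v => by
      rw [Formula.Realize, realize_fT, hu]; rfl⟩)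
  refine ⟨.ex 0 φ, fun v => ?_⟩
  rw [Formula.realize_ex]
  refine exists_congr fun z => (hφ _).trans ?_
  rw [funext_iff]; rfl

/-- With finitely many variables and orders, a type is a finite list of prescribed truth values. -/
theorem isDefinable_sameType [Finite ι] (v : ∀ i, M (σ i)) : IsDefinable (SameType v) := by
  have h₁ : IsDefinable fun w : ∀ i, M (σ i) => ∀ (o o' : Option ι) (j : Fin n),
      tupleCoord v o j < tupleCoord v o' j ↔ tupleCoord w o j < tupleCoord w o' j := by
    refine .forall fun o => .forall fun o' => .forall fun j => IsDefinable.iff_left ?_ _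
    obtain ⟨t, ht⟩ := exists_term_tupleCoord (M := M) (σ := σ) o j
    obtain ⟨t', ht'⟩ := exists_term_tupleCoord (M := M) (σ := σ) o' j
    exact ⟨ltF j t t', fun w => by rw [realize_ltF, ht, ht']; rfl⟩
  obtain ⟨φ, hφ⟩ := h₁.and (.forall fun i => (isDefinable_isImage i).iff_left (IsImage (v i)))
  exact ⟨φ, fun w => (hφ w).trans ⟨fun h => ⟨h.1, h.2⟩, fun h => ⟨h.1, h.2⟩⟩⟩

end Coordinates

/-! ### Minimal supports -/

section Support

open Function

variable {n : ℕ} {M : Fin (n + 1) → Type u} [(lang n).Structure M]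
  {m : ℕ} {σ : Fin m → Fin (n + 1)}

/-- The set `X` is definable with `k` parameters. -/
def IsSupported (X : (∀ i, M (σ i)) → Prop) (k : ℕ) : Prop :=
  ∃ (τ : Fin k → Fin (n + 1)) (ψ : (lang n).Formula (Sum.elim σ τ)) (c : ∀ j, M (τ j)),
    ∀ x, ψ.Realize (pairVal x c) ↔ X x

variable [IsModel M] {X : (∀ i, M (σ i)) → Prop}

/-- If `X` is defined in the same way after replacing one parameter by any other element of the
same type over the others, then this parameter is superfluous. -/
theorem isSupported_of_update {k : ℕ} {τ : Fin (k + 1) → Fin (n + 1)}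
    (ψ : (lang n).Formula (Sum.elim σ τ)) (c : ∀ j, M (τ j)) (l : Fin (k + 1))
    (h : ∀ z, SameType c (update c l z) → ∀ x, ψ.Realize (pairVal x (update c l z)) ↔ X x) :
    IsSupported X k := by
  obtain ⟨θ, hθ⟩ := isDefinable_sameType c
  let τ' : Fin k → Fin (n + 1) := fun j => τ (l.succAbove j)
  let Γ := extend (Sum.elim σ τ') (τ l)
  -- The bound variable takes the place of the `l`-th parameter, and the formula asks that the
  -- completed tuple have the type of `c`.
  let p : ∀ j, (lang n).Term Γ (τ j) := Fin.insertNth (α := fun j => (lang n).Term Γ (τ j)) l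
    (.var (σ := Γ) none) (fun j => .var (σ := Γ) (some (Sum.inr j)))
  let q : ∀ o, (lang n).Term Γ (Sum.elim σ τ o) := fun o => match o with
    | Sum.inl i => .var (σ := Γ) (some (Sum.inl i))
    | Sum.inr j => p j
  refine ⟨τ', .ex (τ l) ((θ.subst p).and (ψ.subst q)), l.removeNth c, fun x => ?_⟩
  have hp : ∀ z, (fun j => (p j).realize (extendVal (pairVal x (l.removeNth c)) z)) =
      update c l z := by
    intro z
    rw [← Fin.insertNth_removeNth]
    funext j
    refine Fin.succAboveCases l ?_ (fun j => ?_) j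
    · rw [Fin.insertNth_apply_same]
      exact congrArg (Term.realize _)
        (Fin.insertNth_apply_same (α := fun j => (lang n).Term Γ (τ j)) l _ _)
    · rw [Fin.insertNth_apply_succAbove]
      exact congrArg (Term.realize _)
        (Fin.insertNth_apply_succAbove (α := fun j => (lang n).Term Γ (τ j)) l _ _ j)
  have hq : ∀ z, (fun o => (q o).realize (extendVal (pairVal x (l.removeNth c)) z)) =
      pairVal x (update c l z) := by
    intro z
    funext o
    rcases o with i | j
    · rfl
    · exact congrFun (hp z) j
  simp only [Formula.realize_ex, Formula.realize_and, Formula.realize_subst]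
  constructor
  · rintro ⟨z, h₁, h₂⟩
    rw [hp, hθ] at h₁
    rw [hq] at h₂
    exact (h z h₁ x).1 h₂
  · intro hx
    have hc : SameType c (update c l (c l)) := by rw [update_eq_self]; exact .refl c
    refine ⟨c l, ?_, ?_⟩
    · rw [hp, hθ]; exact hc
    · rw [hq]; exact (h _ hc x).2 hx

/-- It is definable that two parameter tuples define the same set. -/
theorem exists_formula_forall_iff {k : ℕ} {τ : Fin k → Fin (n + 1)}
    (ψ : (lang n).Formula (Sum.elim σ τ)) :
    ∃ χ : (lang n).Formula (Sum.elim τ τ), ∀ c c' : ∀ j, M (τ j), χ.Realize (pairVal c c') ↔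
      ∀ x, ψ.Realize (pairVal x c) ↔ ψ.Realize (pairVal x c') := by
  let Γ := Sum.elim (Sum.elim τ τ) σ
  let p : ∀ o, (lang n).Term Γ (Sum.elim σ τ o) := fun o => match o with
    | Sum.inl i => .var (σ := Γ) (Sum.inr i)
    | Sum.inr j => .var (σ := Γ) (Sum.inl (Sum.inl j))
  let q : ∀ o, (lang n).Term Γ (Sum.elim σ τ o) := fun o => match o with
    | Sum.inl i => .var (σ := Γ) (Sum.inr i)
    | Sum.inr j => .var (σ := Γ) (Sum.inl (Sum.inr j))
  refine ⟨.allBlock m σ (((ψ.subst p).imp (ψ.subst q)).and ((ψ.subst q).imp (ψ.subst p))),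
    fun c c' => ?_⟩
  rw [Formula.realize_allBlock]
  refine forall_congr' fun x => ?_
  have hp : (fun o => (p o).realize (pairVal (pairVal c c') x)) = pairVal x c := by
    funext o; rcases o with i | j <;> rfl
  have hq : (fun o => (q o).realize (pairVal (pairVal c c') x)) = pairVal x c' := by
    funext o; rcases o with i | j <;> rfl
  simp only [Formula.realize_and, Formula.Realize, Formula.realize_subst, hp, hq]
  exact iff_iff_implies_and_implies.symm

theorem pairVal_update {k : ℕ} {τ : Fin k → Fin (n + 1)} (c c' : ∀ j, M (τ j)) (l : Fin k)
    (z : M (τ l)) :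
    pairVal c (update c' l z) = update (pairVal c c') (Sum.inr l) z := by
  funext o
  rcases o with i | j
  · rfl
  · by_cases h : j = l
    · subst h
      exact (update_self j z c').trans
        (update_self (β := fun o => M (Sum.elim τ τ o)) (Sum.inr j) z (pairVal c c')).symm
    · exact (update_of_ne h z c').trans
        (update_of_ne (β := fun o => M (Sum.elim τ τ o)) (mt Sum.inr_injective.eq_iff.1 h) z
          (pairVal c c')).symm

/-! ### Rigidity of minimal supports -/

section Minimal

variable {k : ℕ} {τ : Fin k → Fin (n + 1)} {ψ : (lang n).Formula (Sum.elim σ τ)}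
  {c : ∀ j, M (τ j)}

theorem not_forall_sameType_update (hmin : ∀ k' < k, ¬ IsSupported X k')
    (l : Fin k) :
    ¬ ∀ z, SameType c (update c l z) → ∀ x, ψ.Realize (pairVal x (update c l z)) ↔ X x := by
  intro h
  cases k with
  | zero => exact l.elim0
  | succ k => exact hmin k (Nat.lt_succ_self k) (isSupported_of_update ψ c l h)

/-- In a minimal support no parameter is definable from another one. -/
theorem coord_ne_of_minimal (hmin : ∀ k' < k, ¬ IsSupported X k')
    (hc : ∀ x, ψ.Realize (pairVal x c) ↔ X x) (l : Fin k) (o : Option (Fin k)) (ho : o ≠ some l) :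
    coord (c l) ≠ tupleCoord c o := by
  intro h
  refine not_forall_sameType_update (ψ := ψ) (c := c) hmin l fun z hz => ?_
  -- The assumed equality of coordinates belongs to the type of `c`, so it leaves no other choice
  -- for `z`.
  have : z = c l := by
    refine coord_injective ?_
    rw [h]
    funext j
    have := (hz.eq_iff (some l) o j).1 (congrFun h j)
    rwa [tupleCoord_update_self, tupleCoord_update_of_ne c l z ho] at this
  rw [this, update_eq_self]
  exact hc

/-- The parameters of a minimal support are definable from any other support given by the same
formula. -/
theorem exists_coord_eq_of_minimal (hmin : ∀ k' < k, ¬ IsSupported X k')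
    (hc : ∀ x, ψ.Realize (pairVal x c) ↔ X x) {c' : ∀ j, M (τ j)}
    (hc' : ∀ x, ψ.Realize (pairVal x c') ↔ X x) (l : Fin k) :
    ∃ i, coord (c l) = coord (c' i) := by
  by_contra! hne
  have h0 : coord (c l) ≠ coord (zero M) := coord_ne_of_minimal hmin hc l none (by simp)
  refine not_forall_sameType_update (ψ := ψ) (c := c) hmin l fun z hz => ?_
  by_cases hzl : z = c l
  · rw [hzl, update_eq_self]; exact hc
  have hzlt : ∀ o : Option (Fin k), o ≠ some l → ∀ j,
      (tupleCoord c o j < coord (c l) j ↔ tupleCoord c o j < coord z j) ∧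
      (coord (c l) j < tupleCoord c o j ↔ coord z j < tupleCoord c o j) := by
    intro o ho j
    have h₁ := hz.lt_iff o (some l) j
    have h₂ := hz.lt_iff (some l) o j
    rw [tupleCoord_update_self, tupleCoord_update_of_ne c l z ho] at h₁ h₂
    exact ⟨h₁, h₂⟩
  have hzero : ∀ j, coord (c l) j = coord (zero M) j → coord z j = coord (zero M) j := by
    intro j hj
    have := (hz.eq_iff (some l) none j).1 hj
    rwa [tupleCoord_update_self, tupleCoord_update_of_ne c l z (by simp)] at this
  have hzI : IsImage (c l) ↔ IsImage z := by
    simpa using hz.isImage_iff l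
  -- `y` stays in the cuts of `c l` over `0`, all of `c'` and the other entries of `c`, but departs
  -- from `c l` in the direction of `z`.
  obtain ⟨y, hyI, hy0, hyp, hyl⟩ := exists_near hzl h0 hzero
    (ι := {o : Option (Fin k ⊕ Fin k) // o ≠ some (Sum.inr l)})
    (fun o => tupleCoord (pairVal c' c) o.1)
    (fun o => exists_coord_eq_tupleCoord _ _)
    (by
      rintro ⟨_ | i | i, hi⟩
      · exact h0
      · exact hne i
      · exact coord_ne_of_minimal hmin hc l (some i) (by simpa using hi))
  have hy : ∀ o : Option (Fin k ⊕ Fin k), o ≠ some (Sum.inr l) → ∀ j,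
      (tupleCoord (pairVal c' c) o j < coord (c l) j ↔
        tupleCoord (pairVal c' c) o j < coord y j) ∧
      (coord (c l) j < tupleCoord (pairVal c' c) o j ↔
        coord y j < tupleCoord (pairVal c' c) o j) := by
    intro o ho j
    by_cases hj : coord (c l) j = coord (zero M) j
    · rw [hj, hy0 j hj]; exact ⟨Iff.rfl, Iff.rfl⟩
    · exact hyp ⟨o, ho⟩ j hj
  obtain ⟨χ, hχ⟩ := exists_formula_forall_iff (M := M) ψ
  -- Formulas cannot tell `(c', c)` from `(c', update c l y)`, and `c'` and `c` define the same set.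
  have h₁ : ∀ x, ψ.Realize (pairVal x (update c l y)) ↔ X x := by
    have hS : SameType (pairVal c' c) (pairVal c' (update c l y)) := by
      have := sameType_update (pairVal c' c) (Sum.inr l) (x := c l) (y := y) hyI hy
      rwa [← pairVal_update, ← pairVal_update, update_eq_self] at this
    have := (hχ _ _).1 ((SameType.realize_iff χ hS).1
      ((hχ c' c).2 fun x => (hc' x).trans (hc x).symm))
    exact fun x => (this x).symm.trans (hc' x)
  -- Now `c` replaces `c'` as reference tuple. Over the other entries `y` and `z` lie in the same
  -- cuts, and `hyl` compares both with `c l`; thus what holds for the nearby `y` transfers to the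
  -- arbitrary `z`.
  have hS : SameType (pairVal c (update c l y)) (pairVal c (update c l z)) := by
    rw [pairVal_update, pairVal_update]
    have hy' : ∀ o : Option (Fin k), o ≠ some l → ∀ j,
        (tupleCoord c o j < coord y j ↔ tupleCoord c o j < coord z j) ∧
        (coord y j < tupleCoord c o j ↔ coord z j < tupleCoord c o j) := by
      intro o ho j
      have h₁ := hy (o.map Sum.inr) (by cases o <;> simp_all) j
      have h₂ : tupleCoord (pairVal c' c) (o.map Sum.inr) = tupleCoord c o := by
        cases o <;> rfl
      rw [h₂] at h₁
      have h₃ := hzlt o ho j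
      exact ⟨h₁.1.symm.trans h₃.1, h₁.2.symm.trans h₃.2⟩
    refine sameType_update (pairVal c c) (Sum.inr l) (x := y) (y := z) (hyI.symm.trans hzI) ?_
    rintro (_ | i | i) ho j
    · exact hy' none (by simp) j
    · by_cases hi : i = l
      · subst hi; exact hyl j
      · exact hy' (some i) (by simpa using hi) j
    · exact hy' (some i) (by simpa using ho) j
  have := (hχ _ _).1 ((SameType.realize_iff χ hS).1
    ((hχ _ _).2 fun x => (hc x).trans (h₁ x).symm))
  exact fun x => (this x).symm.trans (hc x)

/-- Two enumerations of the same values which are ordered in the same way are equal. -/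
theorem eq_of_comp_perm_of_lt_iff {ι α : Type*} [Finite ι] [LinearOrder α] {p q : ι → α}
    (π : Equiv.Perm ι) (hπ : ∀ i, p i = q (π i)) (h : ∀ i i', p i < p i' ↔ q i < q i') :
    p = q := by
  classical
  have := Fintype.ofFinite ι
  funext l
  -- Values may repeat, so ranks are compared. Both sides count the `i` with `q i < q l`: the left
  -- by `h`, the right after reindexing by `π`.
  have hcard : (Finset.univ.filter fun i => p i < p l).card =
      (Finset.univ.filter fun i => p i < q l).card := by
    simp only [h _ l]
    refine Finset.card_bij' (fun i _ => π.symm i) (fun i _ => π i) ?_ ?_ ?_ ?_ <;>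
      simp [hπ]
  rcases lt_trichotomy (p l) (q l) with hl | hl | hl
  · refine absurd hcard (Finset.card_lt_card ?_).ne
    rw [Finset.ssubset_iff_of_subset fun i hi => by
      simp only [Finset.mem_filter, Finset.mem_univ, true_and] at hi ⊢; exact hi.trans hl]
    exact ⟨l, by simpa using hl, by simp⟩
  · exact hl
  · refine absurd hcard (Finset.card_lt_card ?_).ne'
    rw [Finset.ssubset_iff_of_subset fun i hi => by
      simp only [Finset.mem_filter, Finset.mem_univ, true_and] at hi ⊢; exact hi.trans hl]
    exact ⟨π.symm l, by simpa [hπ] using hl, by simp [hπ]⟩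

/-- Entries of `c` have pairwise distinct coordinates, so matching them with entries of `c'` is
injective, hence a permutation. In each coordinate it relates two enumerations ordered alike. -/
theorem eq_of_sameType_of_minimal (hmin : ∀ k' < k, ¬ IsSupported X k')
    (hc : ∀ x, ψ.Realize (pairVal x c) ↔ X x) {c' : ∀ j, M (τ j)}
    (hc' : ∀ x, ψ.Realize (pairVal x c') ↔ X x) (hS : SameType c c') : c' = c := by
  choose π hπ using exists_coord_eq_of_minimal hmin hc hc'
  have hinj : Injective π := by
    intro i i' h
    by_contra hii
    exact coord_ne_of_minimal hmin hc i (some i') (by simpa using Ne.symm hii)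
      ((hπ i).trans (by rw [h, ← hπ i']; rfl))
  let π' : Equiv.Perm (Fin k) := Equiv.ofBijective π (Finite.injective_iff_bijective.1 hinj)
  funext l
  refine coord_injective (funext fun j => ?_)
  exact (congrFun (eq_of_comp_perm_of_lt_iff (p := fun i => coord (c i) j)
    (q := fun i => coord (c' i) j) π' (fun i => congrFun (hπ i) j)
    (fun i i' => hS.lt_iff (some i) (some i') j)) l).symm

end Minimal

theorem eliminatesImaginariesIn : (lang n).EliminatesImaginariesIn M := by
  classical
  intro m σ E hE a
  have hex : ∃ k, IsSupported (fun x => E.Realize (pairVal a x)) k :=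
    -- The representative `a` is itself a support; symmetry is used because parameters occupy the
    -- second block of variables.
    ⟨m, σ, E, a, fun x => ⟨fun h => hE.symm h, fun h => hE.symm h⟩⟩
  obtain ⟨τ, ψ, c, hc⟩ := Nat.find_spec hex
  obtain ⟨θ, hθ⟩ := isDefinable_sameType c
  have hmin := fun k' => Nat.find_min hex (m := k')
  have hφ : ∀ x c', (ψ.and (θ.subst fun j => .var (σ := Sum.elim σ τ) (Sum.inr j))).Realize
      (pairVal x c') ↔ ψ.Realize (pairVal x c') ∧ SameType c c' := by
    intro x c'
    exact (Formula.realize_and _ _ _).trans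
      (and_congr Iff.rfl ((Formula.realize_subst _ _ _).trans (hθ c')))
  refine ⟨_, τ, ψ.and (θ.subst fun j => .var (σ := Sum.elim σ τ) (Sum.inr j)), c, fun c' => ?_⟩
  simp only [hφ]
  constructor
  · intro h
    -- The type condition does not involve `x`, so it can be read off at any member of the class,
    -- here `a`.
    have hS : SameType c c' := ((h a).2 (hE.refl a)).2
    exact eq_of_sameType_of_minimal (fun k' => hmin k') hc
      (fun x => ⟨fun hx => (h x).1 ⟨hx, hS⟩, fun hx => ((h x).2 hx).1⟩) hS
  · rintro rfl x
    exact ⟨fun h => (hc x).1 h.1, fun h => ⟨(hc x).2 h, .refl _⟩⟩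

end Support

end VO

theorem mainTheorem4 (n : ℕ) (hn : 1 ≤ n) :
    ManySorted.Language.Theory.EliminatesImaginaries.{u} (VO.theory n) := by
  intro M _ hM
  have : VO.IsModel M := ⟨hn, hM⟩
  exact VO.eliminatesImaginariesIn
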